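/- Let $\mathcal H$ be a separable complex Hilbert space and let $M$ be a (possibly unbounded) self-adjoint operator with dense domain $\mathrm{Dom}\,M\subseteq\mathcal H$. Let $\lambda$ be in the discrete spectrum of $M$, that is, $\lambda$ is an isolated point of $\mathrm{Spec}\,M$ and an eigenvalue of finite multiplicity. Let $(\mathcal L_n)_{n\in\mathbb N}$ be nonzero finite-dimensional subspaces of $\mathcal H$ with $\mathcal L_n\subset\mathrm{Dom}\,M^2=\{x\in \mathrm{Dom}\,M: Mx\in\mathrm{Dom}\,M\}$, and let $\Pi_n$ be the orthogonal projection of $\mathcal H$ onto $\mathcal L_n$. Let $(\delta(n))_{n\in\mathbb N}$ be a sequence of positive numbers with $\delta(n)\to0$ such that $$\|\Pi_nM^k\Pi_n\psi-\lambda^k\psi\|\le\delta(n)\qquad\text{for all } n\in\mathbb N,\ k=0,1,2,$$ and all $\psi\in\mathrm{Dom}\,M$ with $M\psi=\lambda\psi$ and $\|\psi\|=1$. For $z\in\mathbb C$ let $P_n(z):=\Pi_n(z-M)^2|_{\mathcal L_n}$, a linear operator on $\mathcal L_n$ that is a quadratic polynomial in $z$, and let $\mathrm{Spec}\,P_n:=\{z\in\mathbb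 C:\det P_n(z)=0\}$. Then there exist a constant $b>0$, independent of $n$, and points $z_n\in\mathrm{Spec}\,P_n$ such that $$|z_n-\lambda|<b\,\delta(n)^{1/2}\qquad\text{for all } n\in\mathbb N.$$ -/

import Mathlib

namespace SecondOrder

noncomputable section

variable {H : Type*} [NormedAddCommGroup H] [InnerProductSpace ℂ H]

/-- The composition `S T` of two partially defined operators, on its natural domain
`{x ∈ Dom T : T x ∈ Dom S}`. -/
def pcomp (S T : H →ₗ.[ℂ] H) : H →ₗ.[ℂ] H where
  domain :=
    { carrier := {x | ∃ hx : x ∈ T.domain, T ⟨x, hx⟩ ∈ S.domain}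
      zero_mem' := ⟨T.domain.zero_mem, by
        have h : T ⟨0, T.domain.zero_mem⟩ = 0 := T.map_zero
        rw [h]
        exact S.domain.zero_mem⟩
      add_mem' := by
        rintro x y ⟨hx, hx'⟩ ⟨hy, hy'⟩
        refine ⟨T.domain.add_mem hx hy, ?_⟩
        have h : T ⟨x + y, T.domain.add_mem hx hy⟩ = T ⟨x, hx⟩ + T ⟨y, hy⟩ :=
          T.map_add ⟨x, hx⟩ ⟨y, hy⟩
        rw [h]
        exact S.domain.add_mem hx' hy'
      smul_mem' := by
        rintro c x ⟨hx, hx'⟩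
        refine ⟨T.domain.smul_mem c hx, ?_⟩
        have h : T ⟨c • x, T.domain.smul_mem c hx⟩ = c • T ⟨x, hx⟩ :=
          T.map_smul c ⟨x, hx⟩
        rw [h]
        exact S.domain.smul_mem c hx' }
  toFun :=
    { toFun := fun x => S ⟨T ⟨x.1, x.2.fst⟩, x.2.snd⟩
      map_add' := fun x y => by
        rw [← S.map_add]
        congr 1
        exact Subtype.ext (T.map_add ⟨x.1, x.2.fst⟩ ⟨y.1, y.2.fst⟩)
      map_smul' := fun c x => by
        rw [RingHom.id_apply, ← S.map_smul]
        congr 1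
        exact Subtype.ext (T.map_smul c ⟨x.1, x.2.fst⟩) }

/-- The powers `T ^ k` of a partially defined operator, on their natural domains:
`T ^ 0` is the identity of `H`, and `T ^ (k + 1) = T T ^ k`. -/
def ppow (T : H →ₗ.[ℂ] H) : ℕ → (H →ₗ.[ℂ] H)
  | 0 => (LinearMap.id : H →ₗ[ℂ] H).toPMap ⊤
  | k + 1 => pcomp T (ppow T k)

/-- The operator `z - M`, with `Dom (z - M) = Dom M`. -/
def shift (M : H →ₗ.[ℂ] H) (z : ℂ) : H →ₗ.[ℂ] H where
  domain := M.domain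
  toFun := z • M.domain.subtype - M.toFun

/-- `z` is in the resolvent set of `M` if `z - M : Dom M → H` has a bounded two-sided inverse. -/
def resolventSet (M : H →ₗ.[ℂ] H) : Set ℂ :=
  {z | ∃ R : H →L[ℂ] H,
    (∀ y : H, ∃ hy : R y ∈ (shift M z).domain, shift M z ⟨R y, hy⟩ = y) ∧
    ∀ x : (shift M z).domain, R (shift M z x) = x}

/-- The spectrum of a (possibly unbounded) operator. -/
def Spec (M : H →ₗ.[ℂ] H) : Set ℂ := (resolventSet M)ᶜ

/-- The eigenspace `{x ∈ Dom M : M x = l x}`. -/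
def eigenspace (M : H →ₗ.[ℂ] H) (l : ℂ) : Submodule ℂ H :=
  (LinearMap.ker (shift M l).toFun).map (shift M l).domain.subtype

theorem mem_eigenspace {M : H →ₗ.[ℂ] H} {l : ℂ} {x : H} :
    x ∈ eigenspace M l ↔ ∃ hx : x ∈ M.domain, M ⟨x, hx⟩ = l • x := by
  constructor
  · rintro ⟨⟨y, hy⟩, h, rfl⟩
    have h' : l • y - M ⟨y, hy⟩ = 0 := h
    exact ⟨hy, (sub_eq_zero.mp h').symm⟩
  · rintro ⟨hx, h⟩
    refine ⟨⟨x, hx⟩, ?_, rfl⟩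
    have h' : l • x - M ⟨x, hx⟩ = 0 := sub_eq_zero.mpr h.symm
    exact h'

/-- The discrete spectrum: the eigenvalues of finite multiplicity that are isolated points of the
spectrum. -/
def discSpec (M : H →ₗ.[ℂ] H) : Set ℂ :=
  {l | l ∈ Spec M ∧ (∃ ε > 0, ∀ w ∈ Spec M, ‖w - l‖ < ε → w = l) ∧
    eigenspace M l ≠ ⊥ ∧ FiniteDimensional ℂ (eigenspace M l)}

/-- The compression `Π T|L` of `T` to a subspace `L ⊆ Dom T`, where `Π` is the orthogonal
projection onto `L`. -/
def compress (L : Submodule ℂ H) [FiniteDimensional ℂ L] (T : H →ₗ.[ℂ] H) (hL : L ≤ T.domain) :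
    L →ₗ[ℂ] L :=
  L.orthogonalProjectionOnto.toLinearMap ∘ₗ T.toFun ∘ₗ Submodule.inclusion hL

theorem ppow_domain_le_of_le_two {M : H →ₗ.[ℂ] H} {k : ℕ} (hk : k ≤ 2) :
    (ppow M 2).domain ≤ (ppow M k).domain := by
  intro x hx
  interval_cases k
  · exact Submodule.mem_top
  · exact hx.fst
  · exact hx

theorem ppow_two_domain_le_shift (M : H →ₗ.[ℂ] H) (z : ℂ) :
    (ppow M 2).domain ≤ (ppow (shift M z) 2).domain := by
  rintro x ⟨⟨_, h1⟩, h2⟩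
  refine ⟨⟨Submodule.mem_top, h1⟩, ?_⟩
  exact M.domain.sub_mem (M.domain.smul_mem z h1) h2

/-- The operator `P(z) = Π (z - M) ^ 2|L` on `L ⊆ Dom M ^ 2`. -/
def quadPoly (M : H →ₗ.[ℂ] H) (L : Submodule ℂ H) [FiniteDimensional ℂ L]
    (hL : L ≤ (ppow M 2).domain) (z : ℂ) : L →ₗ[ℂ] L :=
  compress L (ppow (shift M z) 2) (hL.trans (ppow_two_domain_le_shift M z))

/-- `P(z) = z ^ 2 - 2 z Π M|L + Π M ^ 2|L`: it is a quadratic matrix polynomial with leading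
coefficient the identity. -/
theorem quadPoly_eq (M : H →ₗ.[ℂ] H) (L : Submodule ℂ H) [FiniteDimensional ℂ L]
    (hL : L ≤ (ppow M 2).domain) (z : ℂ) :
    quadPoly M L hL z = z ^ 2 • LinearMap.id
      - (2 * z) • compress L (ppow M 1) (hL.trans (ppow_domain_le_of_le_two (by norm_num)))
      + compress L (ppow M 2) hL := by
  ext x
  obtain ⟨⟨_, h1⟩, h2⟩ := hL x.2
  have h1' : (x : H) ∈ M.domain := h1
  have h2' : M ⟨x, h1'⟩ ∈ M.domain := h2
  have h3 : z • (x : H) - M ⟨x, h1'⟩ ∈ M.domain :=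
    M.domain.sub_mem (M.domain.smul_mem z h1') h2'
  have e : M ⟨z • (x : H) - M ⟨x, h1'⟩, h3⟩ = z • M ⟨x, h1'⟩ - M ⟨M ⟨x, h1'⟩, h2'⟩ := by
    rw [← M.map_smul, ← M.map_sub]
    rfl
  have hP : quadPoly M L hL z x = L.orthogonalProjectionOnto
      (z • (z • (x : H) - M ⟨x, h1'⟩) - M ⟨z • (x : H) - M ⟨x, h1'⟩, h3⟩) := rfl
  have hM1 : compress L (ppow M 1) (hL.trans (ppow_domain_le_of_le_two (by norm_num))) x
      = L.orthogonalProjectionOnto (M ⟨x, h1'⟩) := rfl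
  have hM2 : compress L (ppow M 2) hL x = L.orthogonalProjectionOnto (M ⟨M ⟨x, h1'⟩, h2'⟩) := rfl
  have hx : L.orthogonalProjectionOnto (x : H) = x :=
    Submodule.orthogonalProjectionOnto_mem_subspace_eq_self x
  rw [hP, e, LinearMap.add_apply, LinearMap.sub_apply, LinearMap.smul_apply,
    LinearMap.smul_apply, hM1, hM2]
  simp only [map_sub, map_smul, hx, LinearMap.id_apply]
  congr 1
  module

/-- The spectrum of the matrix polynomial `P`: the zeros of `det P(z)`. -/
def polySpec (M : H →ₗ.[ℂ] H) (L : Submodule ℂ H) [FiniteDimensional ℂ L]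
    (hL : L ≤ (ppow M 2).domain) : Set ℂ :=
  {z | LinearMap.det (quadPoly M L hL z) = 0}

end

end SecondOrder

/-!
Let `P(z)` be the compression of `(z - M) ^ 2` to a finite-dimensional `L`, and let `ψ` be a unit
eigenvector for `l`. The approximation hypothesis for `k = 0, 1, 2`, combined with the coefficients
of `(z - M) ^ 2`, says that `P(z) Π ψ` is within `η = O(δ)` of `(z - l) ^ 2 ψ`, uniformly for `z`
near `l` (`norm_quadPoly_sub_le`). So `Π ψ`, whose norm is at least `1 / 2`, is almost annihilated
by `P(l)`.

On the circle `‖z - l‖ = r`, on the other hand, `‖P(z) v‖ ≥ (r ^ 2 - 2 η) / 3 * ‖v‖` for all `v` in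
`L` (`le_norm_quadPoly`). The numerical range of `P(z)` does not give this: at `z = l ± i r` the
number `(z - l) ^ 2 = - r ^ 2` lies opposite to the positive contribution of the rest of the
spectrum. The two are aligned by testing `P(z) v` not against `v = e + u`, where `e` is the
component of `v` in the eigenspace, but against `v + κ̄ Π e`, where `κ` is such that
`(1 + κ) (z - l) ^ 2 = r ^ 2`. As `P(z)` is adjoint to `P(z̄)`, the cost of replacing `e` by `Π e`
is again `O(η)`. The component `u` is controlled by the spectral gap `‖(l - M) u‖ ≥ d ‖u‖` on the
orthogonal complement of the eigenspace (`exists_gap`), which comes from the continuous functional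
calculus of the resolvent at a real point near `l`.

If `P(z)` were invertible on the whole disc, the maximum principle for `z ↦ P(z)⁻¹ P(l) Π ψ` would
carry the lower bound from the circle to the centre (`exists_det_eq_zero_of_norm_lt`). With
`r ^ 2 = 10 η` this contradicts the smallness of `P(l) Π ψ`, so `det P` has a zero in the disc, and
`r` is a multiple of `δ ^ (1 / 2)`. For the finitely many `n` for which `δ n` is not small, any zero
of `det P` will do; one exists by the same maximum principle on a large disc (`polySpec_nonempty`).
-/

open scoped ComplexConjugate InnerProductSpace

namespace SecondOrder

/-! ### Zeros of determinants and the maximum principle -/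

/-- If the holomorphic family `P` is bounded below by `m` on a circle but not at the centre `c`,
then some `P z` in the disc is singular: otherwise `z ↦ (P z)⁻¹ (P c v₀)` would violate the maximum
principle. -/
theorem exists_det_eq_zero_of_norm_lt {V : Type*} [NormedAddCommGroup V] [NormedSpace ℂ V]
    [FiniteDimensional ℂ V] {P : ℂ → V →ₗ[ℂ] V}
    (hP : Differentiable ℂ fun z => Module.End.toContinuousLinearMap V (P z))
    {c : ℂ} {r m : ℝ} (hr : 0 < r) (hm : 0 < m)
    (hlow : ∀ z : ℂ, ‖z - c‖ = r → ∀ v : V, m * ‖v‖ ≤ ‖P z v‖)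
    {v₀ : V} (hv₀ : ‖P c v₀‖ < m * ‖v₀‖) :
    ∃ z : ℂ, ‖z - c‖ ≤ r ∧ LinearMap.det (P z) = 0 := by
  by_contra! hdet
  have : CompleteSpace V := FiniteDimensional.complete ℂ V
  set T : ℂ → V →L[ℂ] V := fun z => Module.End.toContinuousLinearMap V (P z) with hT
  have hunit : ∀ z ∈ Metric.closedBall c r, IsUnit (T z) := fun z hz =>
    ((LinearMap.isUnit_iff_isUnit_det _).mpr
      (isUnit_iff_ne_zero.mpr (hdet z (mem_closedBall_iff_norm.mp hz)))).map
        (Module.End.toContinuousLinearMap V)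
  set f : ℂ → V := fun z => Ring.inverse (T z) (P c v₀) with hf
  have hfd : DiffContOnCl ℂ f (Metric.ball c r) := by
    refine DifferentiableOn.diffContOnCl fun z hz => ?_
    rw [closure_ball c hr.ne'] at hz
    exact (((hP z).inverse (hunit z hz)).clm_apply
      (differentiableAt_const _)).differentiableWithinAt
  have hfrontier : ∀ z ∈ frontier (Metric.ball c r), ‖f z‖ ≤ ‖P c v₀‖ / m := by
    intro z hz
    rw [frontier_ball c hr.ne'] at hz
    have h1 : T z (f z) = P c v₀ :=
      DFunLike.congr_fun (Ring.mul_inverse_cancel _ (hunit z (Metric.sphere_subset_closedBall hz)))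
        (P c v₀)
    rw [le_div_iff₀' hm, ← h1]
    exact hlow z (mem_sphere_iff_norm.mp hz) _
  have hcenter := Complex.norm_le_of_forall_mem_frontier_norm_le Metric.isBounded_ball hfd
    hfrontier (subset_closure (Metric.mem_ball_self hr))
  have hfc : f c = v₀ :=
    DFunLike.congr_fun (Ring.inverse_mul_cancel _ (hunit c (Metric.mem_closedBall_self hr.le))) v₀
  rw [hfc, le_div_iff₀' hm] at hcenter
  exact hcenter.not_gt hv₀

variable {H : Type*} [NormedAddCommGroup H] [InnerProductSpace ℂ H]

/-! ### The spectral gap at an isolated eigenvalue -/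

theorem inner_map_left [CompleteSpace H] {M : H →ₗ.[ℂ] H} (hM : IsSelfAdjoint M) (x y : M.domain) :
    ⟪M x, (y : H)⟫_ℂ = ⟪(x : H), M y⟫_ℂ := by
  have h := LinearPMap.adjoint_isFormalAdjoint hM.dense_domain
  rw [LinearPMap.isSelfAdjoint_def.mp hM] at h
  exact h x y

theorem conj_eq_of_eigenspace_ne_bot [CompleteSpace H] {M : H →ₗ.[ℂ] H} (hM : IsSelfAdjoint M)
    {l : ℂ} (hl : eigenspace M l ≠ ⊥) : conj l = l := by
  obtain ⟨x, hx, hx0⟩ := Submodule.exists_mem_ne_zero_of_ne_bot hl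
  obtain ⟨hxM, hMx⟩ := mem_eigenspace.mp hx
  have h := inner_map_left hM ⟨x, hxM⟩ ⟨x, hxM⟩
  rw [hMx, inner_smul_left, inner_smul_right] at h
  exact mul_right_cancel₀ (inner_self_ne_zero.mpr hx0) h

/-- If `ν` is at most an isolated point of the spectrum of the normal operator `S`, then `S - ν` is
bounded below on the orthogonal complement of its kernel: the function `(w - ν)⁻¹`, cut off at `ν`,
is continuous on the spectrum, and gives a bounded left inverse there. -/
theorem exists_gap_of_isStarNormal [CompleteSpace H] (S : H →L[ℂ] H) (hS : IsStarNormal S) (ν : ℂ)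
    {ε : ℝ} (hε : 0 < ε) (hiso : ∀ w ∈ spectrum ℂ S, ‖w - ν‖ < ε → w = ν) :
    ∃ d : ℝ, 0 < d ∧ ∀ u : H, (∀ x : H, S x = ν • x → ⟪x, u⟫_ℂ = 0) →
      d * ‖u‖ ≤ ‖S u - ν • u‖ := by
  -- with the junk value `g ν = 0`, the function `e` is the indicator of `{ν}`
  set g : ℂ → ℂ := fun w => (w - ν)⁻¹ with hg
  set e : ℂ → ℂ := fun w => 1 - g w * (w - ν) with he
  have heν : e ν = 1 := by simp [he]
  have hene : ∀ w, w ≠ ν → e w = 0 := fun w h => by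
    simp [he, hg, inv_mul_cancel₀ (sub_ne_zero.mpr h)]
  have hgc : ContinuousOn g (spectrum ℂ S) := by
    intro w _
    by_cases h : w = ν
    · refine (continuousWithinAt_const (b := (0 : ℂ))).congr_of_eventuallyEq ?_ (by simp [hg, h])
      rw [h]
      filter_upwards [mem_nhdsWithin_of_mem_nhds (Metric.ball_mem_nhds ν hε), self_mem_nhdsWithin]
        with t ht htS
      simp [hg, hiso t htS (mem_ball_iff_norm.mp ht)]
    · exact ((continuousAt_id.sub continuousAt_const).inv₀
        (sub_ne_zero.mpr h)).continuousWithinAt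
  have hec : ContinuousOn e (spectrum ℂ S) := continuousOn_const.sub (hgc.mul (by fun_prop))
  have hsub : cfc (fun w : ℂ => w - ν) S = S - algebraMap ℂ (H →L[ℂ] H) ν := by
    rw [cfc_sub (fun w : ℂ => w) (fun _ => ν) S, cfc_id' ℂ S, cfc_const ν S]
  have hmul1 : (S - algebraMap ℂ (H →L[ℂ] H) ν) * cfc e S = 0 := by
    rw [← hsub, ← cfc_mul (fun w : ℂ => w - ν) e S (by fun_prop) hec]
    have : (fun w : ℂ => (w - ν) * e w) = 0 := by
      ext w
      by_cases h : w = ν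
      · simp [h]
      · simp [hene w h]
    rw [this, cfc_zero]
  have hmul2 : cfc g S * (S - algebraMap ℂ (H →L[ℂ] H) ν) + cfc e S = 1 := by
    rw [← hsub, ← cfc_mul g (fun w : ℂ => w - ν) S hgc (by fun_prop),
      ← cfc_add S (fun w => g w * (w - ν)) e (hgc.mul (by fun_prop)) hec]
    have : (fun w : ℂ => g w * (w - ν) + e w) = fun _ => 1 := by
      ext w
      simp [he]
    rw [this, cfc_const_one ℂ S]
  have hstar : star (cfc e S) = cfc e S := by
    rw [← cfc_star]
    congr 1
    ext w
    by_cases h : w = ν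
    · simp [h, heν]
    · simp [hene w h]
  -- `cfc e S` is a self-adjoint operator with range in `ker (S - ν)`, so it kills `u`
  refine ⟨(‖cfc g S‖ + 1)⁻¹, by positivity, fun u hu => ?_⟩
  have hker : ∀ y, S (cfc e S y) = ν • cfc e S y := fun y => by
    have := DFunLike.congr_fun hmul1 y
    exact sub_eq_zero.mp this
  have hEu : cfc e S u = 0 := by
    have h := hu _ (hker (cfc e S u))
    rw [← hstar, ContinuousLinearMap.star_eq_adjoint, ContinuousLinearMap.adjoint_inner_left,
      ← ContinuousLinearMap.star_eq_adjoint, hstar] at h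
    exact inner_self_eq_zero.mp h
  have hu2 : cfc g S (S u - ν • u) = u := by
    have : cfc g S (S u - ν • u) + cfc e S u = u := DFunLike.congr_fun hmul2 u
    rwa [hEu, add_zero] at this
  rw [inv_mul_le_iff₀ (by positivity)]
  calc ‖u‖ = ‖cfc g S (S u - ν • u)‖ := by rw [hu2]
    _ ≤ ‖cfc g S‖ * ‖S u - ν • u‖ := ContinuousLinearMap.le_opNorm _ _
    _ ≤ _ := by gcongr; linarith

/-- The resolvent `R = (z - M)⁻¹`, with its defining identities unfolded in terms of `M`. -/
theorem exists_resolvent {M : H →ₗ.[ℂ] H} {z : ℂ} (hz : z ∈ resolventSet M) :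
    ∃ R : H →L[ℂ] H, (∀ y, ∃ hy : R y ∈ M.domain, M ⟨R y, hy⟩ = z • R y - y) ∧
      ∀ x : M.domain, R (z • (x : H) - M x) = x := by
  obtain ⟨R, h1, h2⟩ := hz
  refine ⟨R, fun y => ?_, h2⟩
  obtain ⟨hy, hy'⟩ := h1 y
  refine ⟨hy, ?_⟩
  have hy'' : z • R y - M ⟨R y, hy⟩ = y := hy'
  exact (sub_eq_of_eq_add (sub_eq_iff_eq_add'.mp hy'')).symm

/-- Spectral mapping for `S = (μ - M)⁻¹`: from `w - S = w (μ - w⁻¹ - M) S` one reads off the inverse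
`w⁻¹ (1 + w⁻¹ R)`, where `R` is the resolvent of `M` at `μ - w⁻¹`. -/
theorem notMem_spectrum_resolvent {M : H →ₗ.[ℂ] H} {μ w : ℂ} (hw : w ≠ 0)
    {S : H →L[ℂ] H} (hS1 : ∀ y, ∃ hy : S y ∈ M.domain, M ⟨S y, hy⟩ = μ • S y - y)
    (hS2 : ∀ x : M.domain, S (μ • (x : H) - M x) = x)
    (hz : μ - w⁻¹ ∈ resolventSet M) : w ∉ spectrum ℂ S := by
  obtain ⟨R, hR1, hR2⟩ := exists_resolvent hz
  -- the two resolvent identities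
  have hRS : ∀ y, S (R y) = w • (R y - S y) := fun y => by
    obtain ⟨hy, hMy⟩ := hR1 y
    have h := hS2 ⟨R y, hy⟩
    rw [hMy] at h
    have e : μ • R y - ((μ - w⁻¹) • R y - y) = w⁻¹ • R y + y := by module
    rw [e, map_add, map_smul] at h
    have h' : R y - S y = w⁻¹ • S (R y) := sub_eq_of_eq_add h.symm
    rw [h', smul_inv_smul₀ hw]
  have hSR : ∀ y, R (S y) = w • (R y - S y) := fun y => by
    obtain ⟨hy, hMy⟩ := hS1 y
    have h := hR2 ⟨S y, hy⟩
    rw [hMy] at h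
    have e : (μ - w⁻¹) • S y - (μ • S y - y) = y - w⁻¹ • S y := by module
    rw [e, map_sub, map_smul] at h
    have h' : R y - S y = w⁻¹ • R (S y) := sub_eq_of_eq_add (sub_eq_iff_eq_add'.mp h)
    rw [h', smul_inv_smul₀ hw]
  rw [spectrum.notMem_iff]
  refine isUnit_iff_exists.mpr ⟨w⁻¹ • (1 + w⁻¹ • R), ?_, ?_⟩
  · ext y
    have : w • (w⁻¹ • (y + w⁻¹ • R y)) - S (w⁻¹ • (y + w⁻¹ • R y)) = y := by
      rw [map_smul, map_add, map_smul, hRS]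
      match_scalars <;> field_simp <;> ring
    exact this
  · ext y
    have : w⁻¹ • ((w • y - S y) + w⁻¹ • R (w • y - S y)) = y := by
      rw [map_sub, map_smul, hSR]
      match_scalars <;> field_simp <;> ring
    exact this

/-- A self-adjoint operator has a spectral gap at each point of its discrete spectrum. -/
theorem exists_gap [CompleteSpace H] {M : H →ₗ.[ℂ] H} (hM : IsSelfAdjoint M) {l : ℂ}
    (hl : l ∈ discSpec M) :
    ∃ d : ℝ, 0 < d ∧ ∀ u : M.domain, (u : H) ∈ (eigenspace M l)ᗮ →
      d * ‖(u : H)‖ ≤ ‖l • (u : H) - M u‖ := by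
  obtain ⟨-, ⟨ε, hε, hiso⟩, hne, -⟩ := hl
  have hlconj := conj_eq_of_eigenspace_ne_bot hM hne
  have hres : ∀ z, ‖z - l‖ < ε → z ≠ l → z ∈ resolventSet M := fun z hz hzl => by
    by_contra h
    exact hzl (hiso z h hz)
  -- `l + t` is a real point of the resolvent set, so its resolvent `S` is self-adjoint
  set t : ℂ := ((ε / 2 : ℝ) : ℂ) with ht
  have ht0 : t ≠ 0 := by rw [ht, Complex.ofReal_ne_zero]; positivity
  have htn : ‖t‖ = ε / 2 := by rw [ht, Complex.norm_real, Real.norm_of_nonneg (by positivity)]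
  have hμconj : conj (l + t) = l + t := by rw [map_add, hlconj, ht, Complex.conj_ofReal]
  obtain ⟨S, hS1, hS2⟩ := exists_resolvent (hres (l + t)
    (by rw [add_sub_cancel_left, htn]; linarith) (by simpa using ht0))
  have hSsa : IsSelfAdjoint S := by
    rw [ContinuousLinearMap.isSelfAdjoint_iff_isSymmetric]
    intro x y
    obtain ⟨hx, hMx⟩ := hS1 x
    obtain ⟨hy, hMy⟩ := hS1 y
    have h := inner_map_left hM ⟨S x, hx⟩ ⟨S y, hy⟩
    rw [hMx, hMy] at h
    simp only [inner_sub_left, inner_sub_right, inner_smul_left, inner_smul_right, hμconj] at h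
    exact (sub_right_inj.mp h).symm
  -- `t⁻¹` is the spectral point of `S` that corresponds to `l`, and it is isolated too
  have htinv : ∀ᶠ w in nhds t⁻¹, w ≠ 0 ∧ ‖t - w⁻¹‖ < ε := by
    refine (continuousAt_id.eventually_ne (inv_ne_zero ht0)).and ?_
    have : ContinuousAt (fun w : ℂ => ‖t - w⁻¹‖) t⁻¹ :=
      (continuousAt_const.sub (continuousAt_inv₀ (inv_ne_zero ht0))).norm
    exact this.eventually_lt continuousAt_const (by simpa using hε)
  obtain ⟨η, hη, hball⟩ := Metric.eventually_nhds_iff.mp htinv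
  obtain ⟨d, hd, hgap⟩ := exists_gap_of_isStarNormal S hSsa.isStarNormal t⁻¹ hη
    (fun w hw hwt => by
      by_contra hne'
      obtain ⟨hw0, hwε⟩ := hball (show dist w t⁻¹ < η by rwa [dist_eq_norm])
      refine notMem_spectrum_resolvent hw0 hS1 hS2 (hres _ ?_ ?_) hw
      · rwa [show l + t - w⁻¹ - l = t - w⁻¹ by ring]
      · intro h
        apply hne'
        rw [← inv_inv w]
        congr 1
        linear_combination -h)
  refine ⟨d * ‖t‖ / (‖S‖ + 1), by positivity, fun u hu => ?_⟩
  set y : H := (l + t) • (u : H) - M u with hy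
  have hSy : S y = u := hS2 u
  -- `S y - t⁻¹ • y = -t⁻¹ • (l - M) u`, and `y` is again orthogonal to the eigenspace
  have hid : S y - t⁻¹ • y = -(t⁻¹ • (l • (u : H) - M u)) := by
    rw [hSy, hy]
    match_scalars <;> field_simp
    ring
  have hyorth : ∀ x : H, S x = t⁻¹ • x → ⟪x, y⟫_ℂ = 0 := by
    intro x hx
    obtain ⟨hxM, hMx⟩ := hS1 x
    have hxl : S x ∈ eigenspace M l := by
      refine mem_eigenspace.mpr ⟨hxM, ?_⟩
      rw [hMx, hx]
      match_scalars
      field_simp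
      ring
    have hx' : x = t • S x := by rw [hx, smul_smul, mul_inv_cancel₀ ht0, one_smul]
    have hsym : ⟪S x, y⟫_ℂ = ⟪x, S y⟫_ℂ :=
      (ContinuousLinearMap.isSelfAdjoint_iff_isSymmetric.mp hSsa) x y
    have hxu : ⟪S x, (u : H)⟫_ℂ = 0 := (Submodule.mem_orthogonal _ _).mp hu _ hxl
    rw [hx', inner_smul_left, hsym, hSy, hx', inner_smul_left, hxu]
    simp
  have h1 := hgap y hyorth
  rw [hid, norm_neg, norm_smul, norm_inv, ← div_eq_inv_mul, le_div_iff₀ (norm_pos_iff.mpr ht0)] at h1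
  have h2 : ‖(u : H)‖ ≤ (‖S‖ + 1) * ‖y‖ := by
    rw [← hSy]
    exact (S.le_opNorm y).trans (by gcongr; linarith)
  calc d * ‖t‖ / (‖S‖ + 1) * ‖(u : H)‖ ≤ d * ‖t‖ / (‖S‖ + 1) * ((‖S‖ + 1) * ‖y‖) := by gcongr
    _ = d * ‖y‖ * ‖t‖ := by field_simp
    _ ≤ _ := h1

/-! ### The quadratic form of the compression -/

theorem ppow_two_domain_le (M : H →ₗ.[ℂ] H) : (ppow M 2).domain ≤ M.domain := by
  rintro x ⟨⟨_, h1⟩, -⟩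
  exact h1

/-- `P(z)` represents the form `⟪(z̄ - M) w, (z - M) x⟫` on `L`; in particular `P(z)` is adjoint to
`P(z̄)`. -/
theorem inner_quadPoly [CompleteSpace H] {M : H →ₗ.[ℂ] H} (hM : IsSelfAdjoint M)
    {L : Submodule ℂ H} [FiniteDimensional ℂ L] (hL : L ≤ (ppow M 2).domain) (z : ℂ) (w x : L) :
    ⟪(w : H), quadPoly M L hL z x⟫_ℂ =
      ⟪conj z • (w : H) - M ⟨w, ppow_two_domain_le M (hL w.2)⟩,
        z • (x : H) - M ⟨x, ppow_two_domain_le M (hL x.2)⟩⟫_ℂ := by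
  obtain ⟨⟨_, h1⟩, h2⟩ := hL x.2
  have h1' : (x : H) ∈ M.domain := h1
  have h2' : M ⟨x, h1'⟩ ∈ M.domain := h2
  have h3 : z • (x : H) - M ⟨x, h1'⟩ ∈ M.domain :=
    M.domain.sub_mem (M.domain.smul_mem z h1') h2'
  have hP : quadPoly M L hL z x = L.orthogonalProjectionOnto
      (z • (z • (x : H) - M ⟨x, h1'⟩) - M ⟨z • (x : H) - M ⟨x, h1'⟩, h3⟩) := rfl
  rw [hP, ← Submodule.coe_inner, Submodule.inner_orthogonalProjectionOnto_eq_of_mem_left,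
    inner_sub_right, inner_sub_left, inner_smul_right, inner_smul_left, Complex.conj_conj,
    inner_map_left hM ⟨w, _⟩ ⟨_, h3⟩]

/-- The approximation hypothesis passes from the powers of `M` to `P(z)`, and by homogeneity from unit
eigenvectors to all of the eigenspace. -/
theorem norm_quadPoly_sub_le {M : H →ₗ.[ℂ] H} {l : ℂ} {L : Submodule ℂ H}
    [FiniteDimensional ℂ L] (hL : L ≤ (ppow M 2).domain) {δ : ℝ}
    (happrox : ∀ ψ ∈ eigenspace M l, ‖ψ‖ = 1 → ∀ k : ℕ, ∀ hk : k ≤ 2,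
      ‖(compress L (ppow M k) (hL.trans (ppow_domain_le_of_le_two hk))
          (L.orthogonalProjectionOnto ψ) : H) - l ^ k • ψ‖ ≤ δ)
    (z : ℂ) {ψ : H} (hψ : ψ ∈ eigenspace M l) :
    ‖(quadPoly M L hL z (L.orthogonalProjectionOnto ψ) : H) - (z - l) ^ 2 • ψ‖
      ≤ (‖z‖ + 1) ^ 2 * δ * ‖ψ‖ := by
  have hunit : ∀ ψ ∈ eigenspace M l, ‖ψ‖ = 1 →
      ‖(quadPoly M L hL z (L.orthogonalProjectionOnto ψ) : H) - (z - l) ^ 2 • ψ‖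
        ≤ (‖z‖ + 1) ^ 2 * δ := by
    intro ψ hψ h1
    have h0 := happrox ψ hψ h1 0 (by norm_num)
    have h2 := happrox ψ hψ h1 1 (by norm_num)
    have h3 := happrox ψ hψ h1 2 le_rfl
    set x := L.orthogonalProjectionOnto ψ with hx
    have hid : compress L (ppow M 0) (hL.trans (ppow_domain_le_of_le_two (by norm_num))) x = x :=
      Submodule.orthogonalProjectionOnto_mem_subspace_eq_self x
    rw [hid, pow_zero, one_smul] at h0
    rw [pow_one] at h2
    rw [quadPoly_eq]
    simp only [LinearMap.add_apply, LinearMap.sub_apply, LinearMap.smul_apply, LinearMap.id_apply,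
      Submodule.coe_add, Submodule.coe_sub, Submodule.coe_smul]
    set y₁ : H := (compress L (ppow M 1) (hL.trans (ppow_domain_le_of_le_two (by norm_num))) x : H)
    set y₂ : H := (compress L (ppow M 2) hL x : H)
    calc ‖z ^ 2 • (x : H) - (2 * z) • y₁ + y₂ - (z - l) ^ 2 • ψ‖
        = ‖z ^ 2 • ((x : H) - ψ) - (2 * z) • (y₁ - l • ψ) + (y₂ - l ^ 2 • ψ)‖ := by
          congr 1
          module
      _ ≤ ‖z ^ 2 • ((x : H) - ψ)‖ + ‖(2 * z) • (y₁ - l • ψ)‖ + ‖y₂ - l ^ 2 • ψ‖ :=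
          (norm_add_le _ _).trans (by gcongr; exact norm_sub_le _ _)
      _ ≤ ‖z‖ ^ 2 * δ + 2 * ‖z‖ * δ + δ := by
          rw [norm_smul, norm_smul, norm_pow, norm_mul, Complex.norm_ofNat]
          gcongr
      _ = (‖z‖ + 1) ^ 2 * δ := by ring
  rcases eq_or_ne ψ 0 with rfl | h0
  · simp
  have hn : (0 : ℝ) < ‖ψ‖ := norm_pos_iff.mpr h0
  have hc : ((‖ψ‖ : ℝ) : ℂ) ≠ 0 := Complex.ofReal_ne_zero.mpr hn.ne'
  have h := hunit (((‖ψ‖ : ℝ) : ℂ)⁻¹ • ψ) (Submodule.smul_mem _ _ hψ) (by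
    rw [norm_smul, norm_inv, Complex.norm_real, norm_norm, inv_mul_cancel₀ hn.ne'])
  rw [map_smul, map_smul, Submodule.coe_smul, smul_comm _ _ ψ, ← smul_sub, norm_smul, norm_inv,
    Complex.norm_real, norm_norm, inv_mul_le_iff₀ hn] at h
  linarith

/-- With `b = (l - M) u` and `ζ = z - l`, the form of `(z - M) ^ 2` at `u` is dominated by `‖b‖ ^ 2`
when `ζ` is small compared with the gap `d`. -/
theorem le_re_inner_of_gap {d r : ℝ} (hr : 0 ≤ r) (hrd : 4 * r ≤ d) {ζ : ℂ} (hζ : ‖ζ‖ = r)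
    {u b : H} (hgap : d * ‖u‖ ≤ ‖b‖) :
    r ^ 2 * ‖u‖ ^ 2 ≤ (⟪conj ζ • u + b, ζ • u + b⟫_ℂ).re := by
  have hub : 4 * r * ‖u‖ ≤ ‖b‖ := le_trans (by gcongr) hgap
  have hexp : ⟪conj ζ • u + b, ζ • u + b⟫_ℂ =
      ζ * ζ * ⟪u, u⟫_ℂ + ζ * ⟪u, b⟫_ℂ + ζ * ⟪b, u⟫_ℂ + ⟪b, b⟫_ℂ := by
    simp only [inner_add_left, inner_add_right, inner_smul_left, inner_smul_right,
      Complex.conj_conj]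
    ring
  have h1 : -(r * r * (‖u‖ * ‖u‖)) ≤ (ζ * ζ * ⟪u, u⟫_ℂ).re :=
    (abs_le.mp ((Complex.abs_re_le_norm _).trans (by
      rw [norm_mul, norm_mul, hζ]; gcongr; exact norm_inner_le_norm _ _))).1
  have h2 : -(r * (‖u‖ * ‖b‖)) ≤ (ζ * ⟪u, b⟫_ℂ).re :=
    (abs_le.mp ((Complex.abs_re_le_norm _).trans (by
      rw [norm_mul, hζ]; gcongr; exact norm_inner_le_norm _ _))).1
  have h3 : -(r * (‖b‖ * ‖u‖)) ≤ (ζ * ⟪b, u⟫_ℂ).re :=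
    (abs_le.mp ((Complex.abs_re_le_norm _).trans (by
      rw [norm_mul, hζ]; gcongr; exact norm_inner_le_norm _ _))).1
  have h4 : (⟪b, b⟫_ℂ).re = ‖b‖ ^ 2 := inner_self_eq_norm_sq (𝕜 := ℂ) b
  rw [hexp, Complex.add_re, Complex.add_re, Complex.add_re, h4]
  have h5 : 0 ≤ r * ‖u‖ := by positivity
  nlinarith [mul_nonneg h5 (sub_nonneg.mpr hub), mul_nonneg (norm_nonneg b) (sub_nonneg.mpr hub)]

/-- The lower bound on circles around `l`: `η` bounds the relative error in
`P(z̄) Π ψ ≈ (z̄ - l) ^ 2 ψ` on the eigenspace, and `d` is the spectral gap. -/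
theorem le_norm_quadPoly [CompleteSpace H] {M : H →ₗ.[ℂ] H} (hM : IsSelfAdjoint M) {l : ℂ}
    (hconj : conj l = l) [FiniteDimensional ℂ (eigenspace M l)] {L : Submodule ℂ H}
    [FiniteDimensional ℂ L] (hL : L ≤ (ppow M 2).domain) {d r η : ℝ} {z : ℂ}
    (hgap : ∀ u : M.domain, (u : H) ∈ (eigenspace M l)ᗮ → d * ‖(u : H)‖ ≤ ‖l • (u : H) - M u‖)
    (hr : 0 < r) (hrd : 4 * r ≤ d) (hz : ‖z - l‖ = r) (hη : 0 ≤ η)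
    (herr : ∀ ψ ∈ eigenspace M l,
      ‖(quadPoly M L hL (conj z) (L.orthogonalProjectionOnto ψ) : H) - (conj z - l) ^ 2 • ψ‖
        ≤ η * ‖ψ‖) (v : L) :
    (r ^ 2 - 2 * η) / 3 * ‖v‖ ≤ ‖quadPoly M L hL z v‖ := by
  set ζ : ℂ := z - l with hζ
  have hζc : conj z - l = conj ζ := by rw [hζ, map_sub, hconj]
  have hvM : (v : H) ∈ M.domain := ppow_two_domain_le M (hL v.2)
  set e : H := (eigenspace M l).starProjection v with he
  have heE : e ∈ eigenspace M l := Submodule.starProjection_apply_mem _ _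
  obtain ⟨heM, hMe⟩ := mem_eigenspace.mp heE
  set u : H := v - e with hu
  have huO : u ∈ (eigenspace M l)ᗮ := Submodule.sub_starProjection_mem_orthogonal _
  have huM : u ∈ M.domain := M.domain.sub_mem hvM heM
  set b : H := l • u - M ⟨u, huM⟩ with hb
  have hveu : (v : H) = e + u := by rw [hu]; abel
  have hMv : M ⟨v, hvM⟩ = l • e + l • u - b := by
    have : (⟨v, hvM⟩ : M.domain) = ⟨e, heM⟩ + ⟨u, huM⟩ := Subtype.ext hveu
    rw [this, M.map_add, hMe, hb]
    abel
  have heu : ⟪e, u⟫_ℂ = 0 := (Submodule.mem_orthogonal _ _).mp huO e heE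
  have hue : ⟪u, e⟫_ℂ = 0 := inner_eq_zero_symm.mp heu
  have heb : ⟪e, b⟫_ℂ = 0 := by
    have := inner_map_left hM ⟨e, heM⟩ ⟨u, huM⟩
    rw [hMe, inner_smul_left, heu, mul_zero] at this
    rw [hb, inner_sub_right, inner_smul_right, heu, mul_zero, ← this, sub_zero]
  have hbe : ⟪b, e⟫_ℂ = 0 := inner_eq_zero_symm.mp heb
  have hee : ⟪e, e⟫_ℂ = (‖e‖ : ℂ) ^ 2 := inner_self_eq_norm_sq_to_K e
  have hpyth : ‖v‖ ^ 2 = ‖e‖ ^ 2 + ‖u‖ ^ 2 := by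
    have := norm_add_sq_eq_norm_sq_add_norm_sq_of_inner_eq_zero e u heu
    rw [← hveu] at this
    simpa [sq] using this
  have hev : ‖e‖ ≤ ‖v‖ := Submodule.norm_starProjection_apply_le _ _
  -- the cross terms vanish, as the eigenspace reduces `M`
  have hdiag : ⟪(v : H), quadPoly M L hL z v⟫_ℂ =
      ζ ^ 2 * (‖e‖ : ℂ) ^ 2 + ⟪conj ζ • u + b, ζ • u + b⟫_ℂ := by
    rw [inner_quadPoly hM hL]
    have h1 : conj z • (v : H) - M ⟨v, hvM⟩ = conj ζ • e + (conj ζ • u + b) := by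
      rw [hMv, hveu, ← hζc]
      module
    have h2 : z • (v : H) - M ⟨v, hvM⟩ = ζ • e + (ζ • u + b) := by
      rw [hMv, hveu, hζ]
      module
    rw [h1, h2, ← hee]
    simp only [inner_add_left, inner_add_right, inner_smul_left, inner_smul_right, heu, hue, heb,
      hbe, Complex.conj_conj]
    ring
  set p : L := L.orthogonalProjectionOnto e with hp
  have hpe : ‖p‖ ≤ ‖v‖ := (Submodule.norm_orthogonalProjectionOnto_apply_le _ _).trans hev
  -- here the hypothesis on `P(z̄) Π e` enters, through the adjoint of `P(z)`
  have hoff : ‖⟪(p : H), quadPoly M L hL z v⟫_ℂ - ζ ^ 2 * (‖e‖ : ℂ) ^ 2‖ ≤ η * ‖v‖ ^ 2 := by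
    have h1 : ⟪(p : H), quadPoly M L hL z v⟫_ℂ = ⟪(quadPoly M L hL (conj z) p : H), v⟫_ℂ := by
      rw [← inner_conj_symm (quadPoly M L hL (conj z) p : H), inner_quadPoly hM hL,
        inner_quadPoly hM hL, inner_conj_symm, Complex.conj_conj]
    have h2 : ζ ^ 2 * (‖e‖ : ℂ) ^ 2 = ⟪(conj z - l) ^ 2 • e, (v : H)⟫_ℂ := by
      rw [hζc, inner_smul_left, hveu, inner_add_right, heu, map_pow, Complex.conj_conj,
        hee, add_zero]
    rw [h1, h2, ← inner_sub_left]
    calc _ ≤ _ := norm_inner_le_norm _ _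
      _ ≤ (η * ‖e‖) * ‖v‖ := by gcongr; exacts [herr e heE, le_rfl]
      _ ≤ (η * ‖v‖) * ‖v‖ := by gcongr
      _ = _ := by ring
  -- `1 + κ` is the unimodular number that rotates `ζ ^ 2` to `r ^ 2`
  set κ : ℂ := conj ζ ^ 2 / (r : ℂ) ^ 2 - 1 with hκ
  have hrc : (r : ℂ) ≠ 0 := Complex.ofReal_ne_zero.mpr hr.ne'
  have hκζ : (1 + κ) * ζ ^ 2 = (r : ℂ) ^ 2 := by
    have : conj ζ * ζ = (r : ℂ) ^ 2 := by rw [Complex.conj_mul', hz]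
    rw [hκ]
    field_simp
    linear_combination (conj ζ * ζ + (r : ℂ) ^ 2) * this
  have hκn : ‖κ‖ ≤ 2 := by
    refine (norm_sub_le _ _).trans ?_
    rw [norm_div, norm_pow, norm_pow, RCLike.norm_conj, hz, Complex.norm_real,
      Real.norm_of_nonneg hr.le, div_self (by positivity), norm_one]
    norm_num
  set w : L := v + conj κ • p with hw
  have hwn : ‖w‖ ≤ 3 * ‖v‖ := by
    refine (norm_add_le _ _).trans ?_
    rw [norm_smul, RCLike.norm_conj]
    nlinarith [mul_le_mul hκn hpe (norm_nonneg _) (by norm_num)]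
  have hform : ⟪(w : H), quadPoly M L hL z v⟫_ℂ =
      (r : ℂ) ^ 2 * (‖e‖ : ℂ) ^ 2 + ⟪conj ζ • u + b, ζ • u + b⟫_ℂ +
        κ * (⟪(p : H), quadPoly M L hL z v⟫_ℂ - ζ ^ 2 * (‖e‖ : ℂ) ^ 2) := by
    rw [hw, Submodule.coe_add, Submodule.coe_smul, inner_add_left, inner_smul_left,
      Complex.conj_conj, hdiag, ← hκζ]
    ring
  have hre : (r ^ 2 - 2 * η) * ‖v‖ ^ 2 ≤ (⟪(w : H), quadPoly M L hL z v⟫_ℂ).re := by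
    have h1 := le_re_inner_of_gap hr.le hrd hz (hgap ⟨u, huM⟩ huO)
    have h2 : -(2 * (η * ‖v‖ ^ 2)) ≤
        (κ * (⟪(p : H), quadPoly M L hL z v⟫_ℂ - ζ ^ 2 * (‖e‖ : ℂ) ^ 2)).re :=
      (abs_le.mp ((Complex.abs_re_le_norm _).trans (by rw [norm_mul]; gcongr))).1
    have h3 : ((r : ℂ) ^ 2 * (‖e‖ : ℂ) ^ 2).re = r ^ 2 * ‖e‖ ^ 2 := by norm_cast
    rw [hform, Complex.add_re, Complex.add_re, h3]
    rw [hpyth] at h2 ⊢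
    linarith
  have hle : (⟪(w : H), quadPoly M L hL z v⟫_ℂ).re ≤ 3 * ‖v‖ * ‖quadPoly M L hL z v‖ :=
    (Complex.re_le_norm _).trans ((norm_inner_le_norm _ _).trans (by gcongr; exacts [hwn, le_rfl]))
  rcases eq_or_ne v 0 with h0 | h0
  · simp [h0]
  · have hv : 0 < ‖v‖ := norm_pos_iff.mpr h0
    nlinarith [le_of_mul_le_mul_right (show ((r ^ 2 - 2 * η) * ‖v‖) * ‖v‖ ≤
      (3 * ‖quadPoly M L hL z v‖) * ‖v‖ by nlinarith) hv]

/-! ### Zeros of the compressed polynomial -/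

theorem differentiable_quadPoly (M : H →ₗ.[ℂ] H) {L : Submodule ℂ H} [FiniteDimensional ℂ L]
    (hL : L ≤ (ppow M 2).domain) :
    Differentiable ℂ fun z => Module.End.toContinuousLinearMap L (quadPoly M L hL z) := by
  simp_rw [quadPoly_eq, map_add, map_sub, map_smul]
  fun_prop

theorem polySpec_nonempty (M : H →ₗ.[ℂ] H) {L : Submodule ℂ H} [FiniteDimensional ℂ L]
    (hL : L ≤ (ppow M 2).domain) (hL0 : L ≠ ⊥) : (polySpec M L hL).Nonempty := by
  obtain ⟨x, hx, hx0⟩ := Submodule.exists_mem_ne_zero_of_ne_bot hL0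
  set v₀ : L := ⟨x, hx⟩
  have hv₀ : 0 < ‖v₀‖ := norm_pos_iff.mpr (Subtype.coe_ne_coe.mp hx0)
  set A := Module.End.toContinuousLinearMap L
    (compress L (ppow M 1) (hL.trans (ppow_domain_le_of_le_two (by norm_num))))
  set B := Module.End.toContinuousLinearMap L (compress L (ppow M 2) hL)
  have hP : ∀ z v, quadPoly M L hL z v = z ^ 2 • v - (2 * z) • A v + B v := fun z v => by
    rw [quadPoly_eq]
    rfl
  set m : ℝ := ‖quadPoly M L hL 0 v₀‖ / ‖v₀‖ + 1 with hm
  have hm0 : 0 < m := by positivity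
  set r : ℝ := 2 * ‖A‖ + ‖B‖ + m + 1 with hr
  have hr1 : 1 ≤ r := by rw [hr]; linarith [norm_nonneg A, norm_nonneg B]
  -- for `‖z‖ = r` the leading term `z ^ 2` of `P(z)` dominates the other two
  obtain ⟨z, -, hz⟩ := exists_det_eq_zero_of_norm_lt (differentiable_quadPoly M hL) (c := 0)
    (by linarith : 0 < r) hm0 (fun z hz v => by
      rw [sub_zero] at hz
      have h1 : z ^ 2 • v = quadPoly M L hL z v + ((2 * z) • A v - B v) := by
        rw [hP]
        abel
      have h2 : r ^ 2 * ‖v‖ ≤ ‖quadPoly M L hL z v‖ + (2 * r * (‖A‖ * ‖v‖) + ‖B‖ * ‖v‖) := by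
        calc r ^ 2 * ‖v‖ = ‖z ^ 2 • v‖ := by rw [norm_smul, norm_pow, hz]
          _ ≤ ‖quadPoly M L hL z v‖ + (‖(2 * z) • A v‖ + ‖B v‖) := by
              rw [h1]
              exact (norm_add_le _ _).trans (by gcongr; exact norm_sub_le _ _)
          _ ≤ _ := by
              rw [norm_smul, norm_mul, Complex.norm_ofNat, hz]
              gcongr
              · exact A.le_opNorm v
              · exact B.le_opNorm v
      have h3 : m ≤ r ^ 2 - 2 * r * ‖A‖ - ‖B‖ := by
        have : r ^ 2 - 2 * r * ‖A‖ - ‖B‖ - m = (r - 1) * (‖B‖ + m) + r := by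
          rw [hr]; ring
        nlinarith [mul_nonneg (sub_nonneg.mpr hr1) (add_nonneg (norm_nonneg B) hm0.le)]
      nlinarith [mul_le_mul_of_nonneg_right h3 (norm_nonneg v)])
    (v₀ := v₀) (by rw [hm, add_mul, div_mul_cancel₀ _ hv₀.ne']; linarith)
  exact ⟨z, hz⟩

/-- The quantitative form of the theorem for one subspace: `r` is a fixed multiple of `δ ^ (1 / 2)`.
The factor `10` makes the bound `(r ^ 2 - 2 η) / 3` on the circle exceed `2 η`, where
`η = (‖l‖ + 2) ^ 2 * δ`. -/
theorem exists_mem_polySpec_norm_sub_le [CompleteSpace H] {M : H →ₗ.[ℂ] H} (hM : IsSelfAdjoint M)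
    {l : ℂ} (hne : eigenspace M l ≠ ⊥) [FiniteDimensional ℂ (eigenspace M l)] {L : Submodule ℂ H}
    [FiniteDimensional ℂ L] (hL : L ≤ (ppow M 2).domain) {d δ r : ℝ}
    (hgap : ∀ u : M.domain, (u : H) ∈ (eigenspace M l)ᗮ → d * ‖(u : H)‖ ≤ ‖l • (u : H) - M u‖)
    (hδ : 0 < δ) (hδ2 : δ ≤ 1 / 2)
    (happrox : ∀ ψ ∈ eigenspace M l, ‖ψ‖ = 1 → ∀ k : ℕ, ∀ hk : k ≤ 2,
      ‖(compress L (ppow M k) (hL.trans (ppow_domain_le_of_le_two hk))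
          (L.orthogonalProjectionOnto ψ) : H) - l ^ k • ψ‖ ≤ δ)
    (hr : 0 < r) (hr1 : r ≤ 1) (hrd : 4 * r ≤ d) (hrδ : r ^ 2 = 10 * ((‖l‖ + 2) ^ 2 * δ)) :
    ∃ z ∈ polySpec M L hL, ‖z - l‖ ≤ r := by
  set η : ℝ := (‖l‖ + 2) ^ 2 * δ with hη
  have hη0 : 0 < η := by positivity
  have hconj := conj_eq_of_eigenspace_ne_bot hM hne
  have herr : ∀ z : ℂ, ‖z - l‖ ≤ 1 → ∀ ψ ∈ eigenspace M l,
      ‖(quadPoly M L hL z (L.orthogonalProjectionOnto ψ) : H) - (z - l) ^ 2 • ψ‖ ≤ η * ‖ψ‖ := by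
    intro z hz ψ hψ
    have hzl : ‖z‖ ≤ ‖l‖ + 1 := by
      have := norm_add_le (z - l) l
      rw [sub_add_cancel] at this
      linarith
    refine (norm_quadPoly_sub_le hL happrox z hψ).trans ?_
    rw [hη]
    gcongr ?_ ^ 2 * _ * _
    linarith
  obtain ⟨x, hx, hx0⟩ := Submodule.exists_mem_ne_zero_of_ne_bot hne
  obtain ⟨ψ, hψ, hψ1⟩ : ∃ ψ ∈ eigenspace M l, ‖ψ‖ = 1 :=
    ⟨((‖x‖ : ℝ) : ℂ)⁻¹ • x, Submodule.smul_mem _ _ hx, by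
      rw [norm_smul, norm_inv, Complex.norm_real, norm_norm,
        inv_mul_cancel₀ (norm_ne_zero_iff.mpr hx0)]⟩
  set p : L := L.orthogonalProjectionOnto ψ with hp
  have hp2 : 1 / 2 ≤ ‖p‖ := by
    have h := happrox ψ hψ hψ1 0 (by norm_num)
    have hid : compress L (ppow M 0) (hL.trans (ppow_domain_le_of_le_two (by norm_num))) p = p :=
      Submodule.orthogonalProjectionOnto_mem_subspace_eq_self p
    rw [hid, pow_zero, one_smul, norm_sub_rev] at h
    have h' := norm_sub_norm_le ψ (p : H)
    rw [hψ1, Submodule.norm_coe] at h'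
    linarith
  have hcenter : ‖quadPoly M L hL l p‖ ≤ η := by
    have h := herr l (by simp) ψ hψ
    rw [sub_self, zero_pow two_ne_zero, zero_smul, sub_zero, hψ1, mul_one] at h
    exact h
  obtain ⟨z, hz, hdet⟩ := exists_det_eq_zero_of_norm_lt (differentiable_quadPoly M hL) (c := l) hr
    (m := (r ^ 2 - 2 * η) / 3) (by linarith)
    (fun z hz v => le_norm_quadPoly hM hconj hL hgap hr hrd hz hη0.le
      (herr (conj z) (by rwa [← hconj, ← map_sub, RCLike.norm_conj, hz])) v)
    (v₀ := p) (by nlinarith)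
  exact ⟨z, hdet, hz⟩

end SecondOrder

theorem theorem2p1 {H : Type*} [NormedAddCommGroup H] [InnerProductSpace ℂ H] [CompleteSpace H]
    [TopologicalSpace.SeparableSpace H]
    (M : H →ₗ.[ℂ] H) (hM : IsSelfAdjoint M)
    (l : ℂ) (hl : l ∈ SecondOrder.discSpec M)
    (L : ℕ → Submodule ℂ H) [∀ n, FiniteDimensional ℂ (L n)] (hL0 : ∀ n, L n ≠ ⊥)
    (hL : ∀ n, L n ≤ (SecondOrder.ppow M 2).domain)
    (δ : ℕ → ℝ) (hδ : ∀ n, 0 < δ n) (hδ0 : Filter.Tendsto δ Filter.atTop (nhds 0))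
    (happrox : ∀ ψ ∈ SecondOrder.eigenspace M l, ‖ψ‖ = 1 → ∀ n : ℕ, ∀ k : ℕ, ∀ hk : k ≤ 2,
      ‖(SecondOrder.compress (L n) (SecondOrder.ppow M k)
          ((hL n).trans (SecondOrder.ppow_domain_le_of_le_two hk))
          ((L n).orthogonalProjectionOnto ψ) : H) - l ^ k • ψ‖ ≤ δ n) :
    ∃ b : ℝ, 0 < b ∧ ∃ z : ℕ → ℂ, ∀ n : ℕ,
      z n ∈ SecondOrder.polySpec M (L n) (hL n) ∧ ‖z n - l‖ < b * (δ n) ^ (1 / 2 : ℝ) := by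
  obtain ⟨d, hd, hgap⟩ := SecondOrder.exists_gap hM hl
  have hne := hl.2.2.1
  have := hl.2.2.2
  simp_rw [← Real.sqrt_eq_rpow]
  set K : ℝ := 10 * (‖l‖ + 2) ^ 2 with hK
  have hK0 : 0 < K := by positivity
  have hlim : Filter.Tendsto (fun n => √(K * δ n)) Filter.atTop (nhds 0) := by
    simpa using (hδ0.const_mul K).sqrt
  obtain ⟨N, hN⟩ := Filter.eventually_atTop.mp
    ((hδ0.eventually_le_const (by norm_num : (0 : ℝ) < 1 / 2)).and
      ((hlim.eventually_le_const one_pos).and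
        (hlim.eventually_le_const (show 0 < d / 4 by positivity))))
  have hex : ∀ n, ∃ z ∈ SecondOrder.polySpec M (L n) (hL n), N ≤ n → ‖z - l‖ ≤ √K * √(δ n) := by
    intro n
    by_cases hn : N ≤ n
    · obtain ⟨h1, h2, h3⟩ := hN n hn
      obtain ⟨z, hz, hzl⟩ := SecondOrder.exists_mem_polySpec_norm_sub_le hM hne (hL n) hgap (hδ n)
        h1 (fun ψ hψ hψ1 => happrox ψ hψ hψ1 n) (Real.sqrt_pos.mpr (mul_pos hK0 (hδ n))) h2
        (by linarith) (by rw [Real.sq_sqrt (mul_pos hK0 (hδ n)).le, hK]; ring)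
      exact ⟨z, hz, fun _ => by rwa [← Real.sqrt_mul hK0.le]⟩
    · obtain ⟨z, hz⟩ := SecondOrder.polySpec_nonempty M (hL n) (hL0 n)
      exact ⟨z, hz, fun h => absurd h hn⟩
  choose z hz hzl using hex
  have hs : ∀ n, 0 < √(δ n) := fun n => Real.sqrt_pos.mpr (hδ n)
  have hsum : 0 ≤ ∑ n ∈ Finset.range N, ‖z n - l‖ / √(δ n) :=
    Finset.sum_nonneg fun n _ => by positivity
  -- the sum takes care of the indices below `N`, and the `1` makes the inequality strict
  refine ⟨√K + ∑ n ∈ Finset.range N, ‖z n - l‖ / √(δ n) + 1, by positivity, z,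
    fun n => ⟨hz n, ?_⟩⟩
  rw [← div_lt_iff₀ (hs n)]
  rcases le_or_gt N n with hn | hn
  · have := (div_le_iff₀ (hs n)).mpr (hzl n hn)
    linarith
  · have := Finset.single_le_sum (f := fun n => ‖z n - l‖ / √(δ n)) (fun n _ => by positivity)
      (Finset.mem_range.mpr hn)
    linarith [Real.sqrt_nonneg K]
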